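/- Let $\alpha\in[0,1)$, let $\rho_1<\rho_2$ be real constants, let $k\ge 4$ be an integer, let $f_0\in H^k(\mathbb R^2)$ be real-valued, and let $T>0$. Let $f:\mathbb R^2\times[0,T]\to\mathbb R$ be a solution on $[0,T]$ of the contour equation of the generalised Muskat problem $$\frac{\partial f}{\partial t}(x,t)=\frac{\rho_2-\rho_1}{4\pi}\,\mathrm{PV}\!\int_{\mathbb R^2}\frac{\big(\nabla f(x,t)-\nabla f(x-y,t)\big)\cdot y}{\big[\,|y|^2+(f(x,t)-f(x-y,t))^2\,\big]^{\frac{3+\alpha}{2}}}\,dy,\qquad f(\cdot,0)=f_0 .$$ That is, $t\mapsto f(\cdot,t)$ belongs to $C([0,T];H^k(\mathbb R^2))$, where each $f(\cdot,t)$ is the continuous representative of its class; for every $x\in\mathbb R^2$ and $t\in[0,T]$ the time derivative (one-sided at $t=0$ and $t=T$) and the principal value exist and the equation holds; and $f(x,0)=f_0(x)$ for almost every $x$. Here $$\mathrm{PV}\int_{\mathbb R^2}F(y)\,dy=\lim_{\varepsilon\to0^+,\ R\to\infty}\ \int_{\varepsilon<|y|<R}F(y)\,dy .$$ Then for all $t\in[0,T]$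 $$\|f(\cdot,t)\|_{L^\infty(\mathbb R^2)}\le\|f_0\|_{L^\infty(\mathbb R^2)} .$$ -/

import Mathlib

open MeasureTheory Set Filter Topology TemperedDistribution
open scoped ENNReal SchwartzMap

noncomputable section

namespace Muskat

/-- The Euclidean plane. -/
abbrev Plane : Type := EuclideanSpace ℝ (Fin 2)

/-- `IsBesselLift k u v`: the real function `u` on the plane is square integrable and the element
`v` of `L²` represents the tempered distribution obtained from `u` by applying the Bessel potential
operator of order `k`, that is, `v̂(ξ) = (1 + |ξ|²) ^ (k / 2) û(ξ)`. The map `u ↦ v` identifies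
`H^k` with `L²`, and the `L²` norm of `v` is one of the standard equivalent norms of `u` in `H^k`. -/
def IsBesselLift (k : ℝ) (u : Plane → ℝ) (v : Lp ℂ 2 (volume : Measure Plane)) : Prop :=
  ∃ h : MemLp (fun x ↦ (u x : ℂ)) 2 (volume : Measure Plane),
    besselPotential Plane ℂ k (h.toLp : 𝓢'(Plane, ℂ)) = (v : 𝓢'(Plane, ℂ))

/-- The real function `u` belongs to the Sobolev space `H^k` of the plane. -/
def MemH (k : ℝ) (u : Plane → ℝ) : Prop :=
  ∃ h : MemLp (fun x ↦ (u x : ℂ)) 2 (volume : Measure Plane),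
    MemSobolev k 2 (h.toLp : 𝓢'(Plane, ℂ))

/-- The curve `t ↦ f t` is continuous from the set of times `I` to `H^k`. -/
def ContinuousOnH (k : ℝ) (f : ℝ → Plane → ℝ) (I : Set ℝ) : Prop :=
  ∃ v : ℝ → Lp ℂ 2 (volume : Measure Plane),
    ContinuousOn v I ∧ ∀ t ∈ I, IsBesselLift k (f t) (v t)

theorem memH_iff_exists_isBesselLift (k : ℝ) (u : Plane → ℝ) :
    MemH k u ↔ ∃ v, IsBesselLift k u v := by
  constructor
  · rintro ⟨h, v, hv⟩
    exact ⟨v, h, hv⟩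
  · rintro ⟨v, h, hv⟩
    exact ⟨h, v, hv⟩

theorem ContinuousOnH.memH {k : ℝ} {f : ℝ → Plane → ℝ} {I : Set ℝ}
    (hf : ContinuousOnH k f I) {t : ℝ} (ht : t ∈ I) : MemH k (f t) := by
  obtain ⟨v, -, hv⟩ := hf
  exact (memH_iff_exists_isBesselLift k (f t)).2 ⟨v t, hv t ht⟩

/-- `HasPV F L`: the principal value integral of `F` over the plane, with symmetric truncation both
at the origin and at infinity, exists and equals `L`. -/
def HasPV (F : Plane → ℝ) (L : ℝ) : Prop :=
  (∀ ε R : ℝ, 0 < ε → IntegrableOn F {y : Plane | ε < ‖y‖ ∧ ‖y‖ < R} volume) ∧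
    Tendsto (fun p : ℝ × ℝ ↦ ∫ y in {y : Plane | p.1 < ‖y‖ ∧ ‖y‖ < p.2}, F y)
      (𝓝[>] (0 : ℝ) ×ˢ atTop) (𝓝 L)

/-- The integrand, as a function of `y`, on the right-hand side of the contour equation for the
interface `x₃ = u (x₁, x₂)`, at the point `x`. -/
def contourKernel (α : ℝ) (u : Plane → ℝ) (x y : Plane) : ℝ :=
  inner ℝ (gradient u x - gradient u (x - y)) y /
    (‖y‖ ^ 2 + (u x - u (x - y)) ^ 2) ^ ((3 + α) / 2)

/-- `f` is a solution on `[0, T]`, in the class `C([0, T]; H^k)`, of the contour equation of the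
generalised Muskat problem with parameter `α`, densities `ρ₁` (above) and `ρ₂` (below), and initial
interface `f₀`. Each `f t` is the continuous representative of its class in `H^k`; the time
derivative is one-sided at the end points of `[0, T]`. -/
structure IsSolution (α ρ₁ ρ₂ k T : ℝ) (f₀ : Plane → ℝ) (f : ℝ → Plane → ℝ) : Prop where
  continuousOnH : ContinuousOnH k f (Icc 0 T)
  continuous : ∀ t ∈ Icc 0 T, Continuous (f t)
  contour_eq : ∀ t ∈ Icc 0 T, ∀ x : Plane, ∃ L : ℝ,
    HasPV (contourKernel α (f t) x) L ∧
      HasDerivWithinAt (fun s ↦ f s x) ((ρ₂ - ρ₁) / (4 * Real.pi) * L) (Icc 0 T) t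
  initial : f 0 =ᵐ[volume] f₀

end Muskat

end

/-! ### Sobolev embedding by Fourier inversion. -/

section SobolevEmbedding

open FourierTransform

/-! The theorem is a maximum principle. At a global maximum `x` of a `C²` function `u` the gradient
vanishes, and in polar coordinates each ray contributes `-r² b' / (r² + b²) ^ ((3 + α) / 2)` with
`b(r) = u x - u (x - rω) ≥ 0`. Up to terms of favourable sign this is minus the derivative of `r ^
(-α) Φ(b / r)`, where `Φ' = (1 + s²) ^ (-(3 + α) / 2)` and `Φ 0 = 0`. Only the boundary term at `ε`
can be positive, and since `b(ε) = O(ε²)` it is `O(ε ^ (1 - α))`. Hence the principal value is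
nonpositive (`integral_ray_le`, `HasPV.nonpos_of_forall_le`).

If `f` exceeded the initial bound, `f - δt` would attain its maximum at a positive time for some `δ
> 0`; there the time derivative of `f` would be at least `δ`, yet the equation makes it nonpositive
(`le_of_contour_eq`). The equation is odd in `f`, which gives the lower bound. Membership in `C([0,
T]; H^k)` supplies `C²` regularity, decay at infinity and uniform continuity in time. -/

theorem memLp_rpow_neg_one_add_norm_sq {E : Type*} [NormedAddCommGroup E] [MeasurableSpace E]
    [BorelSpace E] [InnerProductSpace ℝ E] [FiniteDimensional ℝ E] {s : ℝ}
    (hs : Module.finrank ℝ E < 2 * s) :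
    MemLp (fun x : E ↦ (1 + ‖x‖ ^ 2) ^ (-s / 2)) 2 := by
  have hc : Continuous (fun x : E ↦ (1 + ‖x‖ ^ 2) ^ (-s / 2)) :=
    Continuous.rpow_const (by fun_prop) fun x ↦ Or.inl (by positivity)
  rw [memLp_two_iff_integrable_sq hc.aestronglyMeasurable]
  refine (integrable_rpow_neg_one_add_norm_sq hs).congr (.of_forall fun x ↦ ?_)
  simp only
  rw [← Real.rpow_mul_natCast (by positivity)]
  congr 1
  push_cast
  ring

namespace Muskat

/-- The function `(1 + |ξ|²) ^ (-k / 2) v̂(ξ)`, which is the Fourier transform of the function on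
the plane whose Bessel lift is `v`. -/
noncomputable def amplitude (k : ℝ) (v : Lp ℂ 2 (volume : Measure Plane)) (ξ : Plane) : ℂ :=
  ((1 + ‖ξ‖ ^ 2) ^ (-k / 2) : ℝ) * (𝓕 v : Lp ℂ 2 (volume : Measure Plane)) ξ

theorem IsBesselLift.integral_mul_eq {k : ℝ} {u : Plane → ℝ} {v : Lp ℂ 2 (volume : Measure Plane)}
    (h : IsBesselLift k u v) (φ : 𝓢(Plane, ℂ)) :
    ∫ x, φ x * (u x : ℂ) = ∫ ξ, 𝓕⁻ φ ξ * amplitude k v ξ := by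
  obtain ⟨hu, hv⟩ := h
  -- Inverting the lift moves the multiplier, now of order `-k`, onto `v`.
  have h1 := (besselPotential_neg_apply_eq_iff k (v : 𝓢'(Plane, ℂ)) (hu.toLp : 𝓢'(Plane, ℂ))).2 hv
  have h2 := congrArg (fun T : 𝓢'(Plane, ℂ) ↦ T φ) h1
  simp only [besselPotential, fourierMultiplierCLM_apply_apply] at h2
  rw [← TemperedDistribution.fourier_apply, Lp.fourier_toTemperedDistribution_eq,
    Lp.toTemperedDistribution_apply, Lp.toTemperedDistribution_apply] at h2
  calc _ = ∫ x, φ x • (hu.toLp : Lp ℂ 2 (volume : Measure Plane)) x := by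
        refine integral_congr_ae ?_
        filter_upwards [hu.coeFn_toLp] with x hx
        rw [hx, smul_eq_mul]
    _ = _ := by
        rw [← h2]
        refine integral_congr_ae (.of_forall fun x ↦ ?_)
        simp only
        rw [SchwartzMap.smulLeftCLM_apply_apply (by fun_prop)]
        simp only [smul_eq_mul, amplitude]
        ring

/-- Cauchy–Schwarz: `‖ξ‖ ^ n` costs `n` powers of the weight, and the remaining `k - n` leave it in
`L²` of the plane once `k - n > 1`. -/
theorem integrable_norm_pow_mul_amplitude {k : ℝ} {n : ℕ} (hk : n + 1 < k)
    (v : Lp ℂ 2 (volume : Measure Plane)) :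
    Integrable (fun ξ ↦ ‖ξ‖ ^ n * ‖amplitude k v ξ‖) := by
  have h1 : MemLp (fun x : Plane ↦ (1 + ‖x‖ ^ 2) ^ (-(k - n) / 2)) 2 :=
    memLp_rpow_neg_one_add_norm_sq (by simp; linarith)
  have h2 := (Lp.memLp (𝓕 v : Lp ℂ 2 (volume : Measure Plane)))
  have hc : Continuous (fun x : Plane ↦ (1 + ‖x‖ ^ 2) ^ (-k / 2)) :=
    Continuous.rpow_const (by fun_prop) fun x ↦ Or.inl (by positivity)
  refine (h1.integrable_mul h2.norm).mono ?_ (.of_forall fun ξ ↦ ?_)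
  · refine AEStronglyMeasurable.mul (by fun_prop) (AEStronglyMeasurable.norm ?_)
    exact (Complex.continuous_ofReal.comp hc).aestronglyMeasurable.mul h2.1
  · have hb : (0 : ℝ) < 1 + ‖ξ‖ ^ 2 := by positivity
    have h3 : ‖ξ‖ ^ n ≤ (1 + ‖ξ‖ ^ 2) ^ ((n : ℝ) / 2) := by
      calc ‖ξ‖ ^ n = ((‖ξ‖ ^ 2) ^ ((1 : ℝ) / 2)) ^ n := by
            rw [← Real.sqrt_eq_rpow, Real.sqrt_sq (norm_nonneg _)]
        _ ≤ ((1 + ‖ξ‖ ^ 2) ^ ((1 : ℝ) / 2)) ^ n := by gcongr; simp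
        _ = _ := by rw [← Real.rpow_mul_natCast hb.le]; congr 1; ring
    have h4 : (1 + ‖ξ‖ ^ 2) ^ (-(k - n) / 2) =
        (1 + ‖ξ‖ ^ 2) ^ ((n : ℝ) / 2) * (1 + ‖ξ‖ ^ 2) ^ (-k / 2) := by
      rw [← Real.rpow_add hb]; congr 1; ring
    have h5 : 0 < (1 + ‖ξ‖ ^ 2) ^ (-k / 2) := Real.rpow_pos_of_pos hb _
    have h6 : 0 < (1 + ‖ξ‖ ^ 2) ^ ((n : ℝ) / 2) := Real.rpow_pos_of_pos hb _
    simp only [amplitude, Pi.mul_apply, norm_mul, norm_pow, norm_norm, h4, Complex.norm_real]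
    rw [Real.norm_of_nonneg h5.le, Real.norm_of_nonneg h6.le, mul_assoc]
    gcongr

theorem integrable_amplitude {k : ℝ} (hk : 1 < k) (v : Lp ℂ 2 (volume : Measure Plane)) :
    Integrable (amplitude k v) := by
  have hc : Continuous (fun x : Plane ↦ (1 + ‖x‖ ^ 2) ^ (-k / 2)) :=
    Continuous.rpow_const (by fun_prop) fun x ↦ Or.inl (by positivity)
  have := integrable_norm_pow_mul_amplitude (k := k) (n := 0) (by simpa using hk) v
  simp only [pow_zero, one_mul] at this
  refine (integrable_norm_iff ?_).1 this
  exact (Complex.continuous_ofReal.comp hc).aestronglyMeasurable.mul (Lp.memLp (𝓕 v)).1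

theorem integral_norm_mul_le_eLpNorm_two {X : Type*} [MeasurableSpace X] {μ : Measure X}
    {f g : X → ℂ} (hf : MemLp f 2 μ) (hg : MemLp g 2 μ) :
    ∫ x, ‖f x * g x‖ ∂μ ≤ (eLpNorm f 2 μ).toReal * (eLpNorm g 2 μ).toReal := by
  rw [integral_norm_eq_lintegral_enorm (f := fun x ↦ f x * g x) (hf.1.mul hg.1),
    ← eLpNorm_one_eq_lintegral_enorm, ← ENNReal.toReal_mul]
  have h : eLpNorm (f • g) 1 μ ≤ eLpNorm f 2 μ * eLpNorm g 2 μ :=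
    eLpNorm_smul_le_mul_eLpNorm hg.1 hf.1
  exact ENNReal.toReal_mono (ENNReal.mul_ne_top hf.2.ne hg.2.ne) h

theorem exists_integral_norm_amplitude_le {k : ℝ} (hk : 1 < k) :
    ∃ C : ℝ, ∀ v : Lp ℂ 2 (volume : Measure Plane), ∫ ξ, ‖amplitude k v ξ‖ ≤ C * ‖v‖ := by
  have h1 : MemLp (fun x : Plane ↦ (1 + ‖x‖ ^ 2) ^ (-k / 2)) 2 :=
    memLp_rpow_neg_one_add_norm_sq (by rw [finrank_euclideanSpace_fin]; push_cast; linarith)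
  have h2 : MemLp (fun x : Plane ↦ (((1 + ‖x‖ ^ 2) ^ (-k / 2) : ℝ) : ℂ)) 2 := h1.ofReal
  refine ⟨(eLpNorm (fun x : Plane ↦ (((1 + ‖x‖ ^ 2) ^ (-k / 2) : ℝ) : ℂ)) 2).toReal, fun v ↦ ?_⟩
  rw [← Lp.norm_fourier_eq v, Lp.norm_def]
  exact integral_norm_mul_le_eLpNorm_two h2 (Lp.memLp (𝓕 v))

theorem integral_fourierInv_mul {f g : Plane → ℂ} (hf : Integrable f) (hg : Integrable g) :
    ∫ ξ, 𝓕⁻ f ξ * g ξ = ∫ x, f x * 𝓕⁻ g x := by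
  -- The negated pairing turns the forward transform into the inverse one.
  have := VectorFourier.integral_fourierIntegral_smul_eq_flip (μ := (volume : Measure Plane))
    (ν := (volume : Measure Plane)) (L := -innerₗ Plane) Real.continuous_fourierChar
    (by simp only [LinearMap.neg_apply, innerₗ_apply_apply]; fun_prop) hf hg
  convert! this using 2
  funext x
  rw [Real.fourierInv_eq, VectorFourier.fourierIntegral]
  simp [real_inner_comm x]

theorem continuous_fourierInv {g : Plane → ℂ} (hg : Integrable g) : Continuous (𝓕⁻ g) := by
  have : (𝓕⁻ g) = fun x ↦ 𝓕 g (-x) := funext (Real.fourierInv_eq_fourier_neg g)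
  rw [this]
  exact (VectorFourier.fourierIntegral_continuous Real.continuous_fourierChar
    (by simp only [innerₗ_apply_apply]; fun_prop) hg).comp continuous_neg

theorem IsBesselLift.ofReal_eq_fourierInv {k : ℝ} (hk : 1 < k) {u : Plane → ℝ}
    {v : Lp ℂ 2 (volume : Measure Plane)} (h : IsBesselLift k u v) (hu : Continuous u) (x : Plane) :
    (u x : ℂ) = 𝓕⁻ (amplitude k v) x := by
  have hc := continuous_fourierInv (integrable_amplitude hk v)
  have hu' : Continuous fun x ↦ (u x : ℂ) := by fun_prop
  have hae : ∀ᵐ x, (u x : ℂ) = 𝓕⁻ (amplitude k v) x := by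
    refine ae_eq_of_integral_contDiff_smul_eq hu'.locallyIntegrable hc.locallyIntegrable
      fun g hg hgc ↦ ?_
    have hg₁ : HasCompactSupport (Complex.ofRealCLM ∘ g) := hgc.comp_left rfl
    have hg₂ : ContDiff ℝ (⊤ : ℕ∞) (Complex.ofRealCLM ∘ g) := Complex.ofRealCLM.contDiff.comp hg
    have h1 := h.integral_mul_eq (hg₁.toSchwartzMap hg₂)
    simp only [SchwartzMap.fourierInv_coe] at h1
    rw [integral_fourierInv_mul (SchwartzMap.integrable _) (integrable_amplitude hk v)] at h1
    simpa using h1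
  exact congrFun (Measure.eq_of_ae_eq hae hu' hc) x

/-- The constant is uniform in `u`, so that differences `f t - f s` can be estimated by their lifts.
-/
theorem exists_abs_le_mul_norm_of_isBesselLift {k : ℝ} (hk : 1 < k) :
    ∃ C : ℝ, ∀ (u : Plane → ℝ) (v : Lp ℂ 2 (volume : Measure Plane)), IsBesselLift k u v →
      Continuous u → ∀ x, |u x| ≤ C * ‖v‖ := by
  obtain ⟨C, hC⟩ := exists_integral_norm_amplitude_le hk
  refine ⟨C, fun u v h hu x ↦ le_trans ?_ (hC v)⟩
  rw [← Real.norm_eq_abs, ← Complex.norm_real, h.ofReal_eq_fourierInv hk hu, Real.fourierInv_eq]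
  refine (norm_integral_le_integral_norm _).trans_eq ?_
  simp

theorem IsBesselLift.contDiff {k : ℝ} (hk : 3 < k) {u : Plane → ℝ}
    {v : Lp ℂ 2 (volume : Measure Plane)} (h : IsBesselLift k u v) (hu : Continuous u) :
    ContDiff ℝ 2 u := by
  have h1 : u = fun x ↦ Complex.reCLM (𝓕 (amplitude k v) (-x)) := by
    funext x
    rw [← Real.fourierInv_eq_fourier_neg, ← h.ofReal_eq_fourierInv (by linarith) hu]
    simp
  have h2 : ContDiff ℝ ((2 : ℕ∞) : WithTop ℕ∞) (𝓕 (amplitude k v)) := by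
    refine Real.contDiff_fourier fun n hn ↦ integrable_norm_pow_mul_amplitude ?_ v
    have : n ≤ 2 := by exact_mod_cast hn
    have : (n : ℝ) ≤ 2 := by exact_mod_cast this
    linarith
  rw [h1]
  exact Complex.reCLM.contDiff.comp (h2.comp contDiff_neg)

/-- Riemann–Lebesgue lemma for the integrable amplitude. -/
theorem IsBesselLift.tendsto_zero {k : ℝ} (hk : 1 < k) {u : Plane → ℝ}
    {v : Lp ℂ 2 (volume : Measure Plane)} (h : IsBesselLift k u v) (hu : Continuous u) :
    Tendsto u (cocompact Plane) (𝓝 0) := by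
  have h1 : u = fun x ↦ Complex.reCLM (𝓕 (amplitude k v) (-x)) := by
    funext x
    rw [← Real.fourierInv_eq_fourier_neg, ← h.ofReal_eq_fourierInv hk hu]
    simp
  have h2 : Tendsto (𝓕 (amplitude k v)) (cocompact Plane) (𝓝 0) := by
    have h := tendsto_integral_exp_inner_smul_cocompact (amplitude k v)
    simp only [← Real.fourier_eq] at h
    exact h
  have h3 : Tendsto (fun x : Plane ↦ -x) (cocompact Plane) (cocompact Plane) :=
    (Homeomorph.neg Plane).isClosedEmbedding.tendsto_cocompact
  rw [h1]
  have h4 := (Complex.reCLM.continuous.tendsto 0).comp (h2.comp h3)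
  rw [map_zero] at h4
  exact h4

theorem IsBesselLift.sub {k : ℝ} {u₁ u₂ : Plane → ℝ} {v₁ v₂ : Lp ℂ 2 (volume : Measure Plane)}
    (h₁ : IsBesselLift k u₁ v₁) (h₂ : IsBesselLift k u₂ v₂) :
    IsBesselLift k (fun x ↦ u₁ x - u₂ x) (v₁ - v₂) := by
  obtain ⟨a₁, b₁⟩ := h₁
  obtain ⟨a₂, b₂⟩ := h₂
  have he : (fun x ↦ ((u₁ x - u₂ x : ℝ) : ℂ)) = (fun x ↦ (u₁ x : ℂ)) - fun x ↦ (u₂ x : ℂ) := by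
    funext x; simp
  have ha := he ▸ a₁.sub a₂
  refine ⟨ha, ?_⟩
  have : ha.toLp = a₁.toLp - a₂.toLp := by
    rw [← MemLp.toLp_sub]; congr 1
  rw [this]
  simp only [← Lp.toTemperedDistributionCLM_apply] at *
  simp only [map_sub, b₁, b₂]

theorem ContinuousOnH.tendstoUniformly {k : ℝ} (hk : 1 < k) {f : ℝ → Plane → ℝ} {I : Set ℝ}
    (hf : ContinuousOnH k f I) (hc : ∀ t ∈ I, Continuous (f t)) {t : ℝ} (ht : t ∈ I) :
    TendstoUniformly f (f t) (𝓝[I] t) := by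
  obtain ⟨v, hv, hl⟩ := hf
  obtain ⟨C, hC⟩ := exists_abs_le_mul_norm_of_isBesselLift hk
  have h1 : Tendsto (fun s ↦ C * ‖v t - v s‖) (𝓝[I] t) (𝓝 0) := by
    have : Tendsto (fun s ↦ C * ‖v t - v s‖) (𝓝[I] t) (𝓝 (C * ‖v t - v t‖)) :=
      ((tendsto_const_nhds.sub (hv t ht)).norm).const_mul C
    simpa using this
  rw [Metric.tendstoUniformly_iff]
  intro ε hε
  filter_upwards [h1.eventually_lt_const hε, self_mem_nhdsWithin] with s hs hsI x
  exact (hC _ _ ((hl t ht).sub (hl s hsI)) ((hc t ht).sub (hc s hsI)) x).trans_lt hs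

end Muskat

end SobolevEmbedding

/-! ### Sign of the principal value at a maximum point. -/

namespace Muskat

/-- The contribution of a single ray to the principal value at a maximum point, where `b` is the
drop of the function along the ray. -/
theorem integral_ray_le {α : ℝ} (hα : 0 ≤ α) {b b' : ℝ → ℝ}
    (hb : ∀ r, HasDerivAt b (b' r) r) (hb' : Continuous b') (hb₀ : ∀ r, 0 ≤ b r)
    {ε R : ℝ} (hε : 0 < ε) (hR : ε ≤ R) :
    ∫ r in ε..R, -(r ^ 2 * b' r) / (r ^ 2 + b r ^ 2) ^ ((3 + α) / 2) ≤
      ε ^ (-α) * (b ε / ε) := by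
  set p := (3 + α) / 2 with hp
  set ψ : ℝ → ℝ := fun s ↦ (1 + s ^ 2) ^ (-p) with hψ
  have hψc : Continuous ψ := Continuous.rpow_const (by fun_prop) fun x ↦ Or.inl (by positivity)
  set Φ : ℝ → ℝ := fun h ↦ ∫ s in (0 : ℝ)..h, ψ s with hΦ
  have hΦd : ∀ h, HasDerivAt Φ (ψ h) h := fun h ↦ hψc.integral_hasStrictDerivAt 0 h |>.hasDerivAt
  have hψ₀ : ∀ s, 0 ≤ ψ s := fun s ↦ by positivity
  have hψ₁ : ∀ s, ψ s ≤ 1 := fun s ↦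
    Real.rpow_le_one_of_one_le_of_nonpos (by nlinarith [sq_nonneg s]) (by rw [hp]; linarith)
  have hΦ₀ : ∀ h, 0 ≤ h → 0 ≤ Φ h := fun h hh ↦
    intervalIntegral.integral_nonneg hh fun s _ ↦ hψ₀ s
  have hΦ₁ : ∀ h, 0 ≤ h → Φ h ≤ h := fun h hh ↦ by
    have := intervalIntegral.integral_mono_on (μ := volume) hh (hψc.intervalIntegrable 0 h)
      (continuous_const.intervalIntegrable 0 h) fun s _ ↦ hψ₁ s
    simpa using this
  set Ψ : ℝ → ℝ := fun r ↦ r ^ (-α) * Φ (b r / r) with hΨ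
  set Ψ' : ℝ → ℝ := fun r ↦ (-α * r ^ (-α - 1)) * Φ (b r / r) +
    r ^ (-α) * (ψ (b r / r) * ((b' r * r - b r * 1) / r ^ 2)) with hΨ'
  have hΨd : ∀ r, 0 < r → HasDerivAt Ψ (Ψ' r) r := fun r hr ↦
    (Real.hasDerivAt_rpow_const (Or.inl hr.ne')).mul
      ((hΦd _).comp r ((hb r).div (hasDerivAt_id r) hr.ne'))
  have hbc : Continuous b := continuous_iff_continuousAt.2 fun r ↦ (hb r).continuousAt
  have key : ∫ r in ε..R, -(r ^ 2 * b' r) / (r ^ 2 + b r ^ 2) ^ p ≤ (-Ψ) R - (-Ψ) ε := by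
    refine intervalIntegral.integral_le_sub_of_hasDeriv_right_of_le (g' := fun r ↦ -Ψ' r) hR
      ?_ ?_ ?_ ?_
    · exact fun r hr ↦ (hΨd r (hε.trans_le hr.1)).neg.continuousAt.continuousWithinAt
    · exact fun r hr ↦ (hΨd r (hε.trans hr.1)).neg.hasDerivWithinAt
    · refine ContinuousOn.integrableOn_compact isCompact_Icc ?_
      refine ContinuousOn.div (by fun_prop) ?_ ?_
      · refine ContinuousOn.rpow_const (by fun_prop) fun r hr ↦ Or.inl ?_
        have := hε.trans_le hr.1
        positivity
      · intro r hr
        have := hε.trans_le hr.1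
        positivity
    · intro r hr
      have hr : 0 < r := hε.trans hr.1
      have e1 : (r ^ 2 + b r ^ 2) ^ p = r ^ 3 * r ^ α * (1 + (b r / r) ^ 2) ^ p := by
        have : r ^ 2 + b r ^ 2 = r ^ 2 * (1 + (b r / r) ^ 2) := by field_simp
        rw [this, Real.mul_rpow (by positivity) (by positivity), ← Real.rpow_natCast r 2,
          ← Real.rpow_mul hr.le, ← Real.rpow_natCast r 3, ← Real.rpow_add hr]
        congr 2
        rw [hp]; push_cast; ring
      have e2 : ψ (b r / r) = ((1 + (b r / r) ^ 2) ^ p)⁻¹ := Real.rpow_neg (by positivity) _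
      have e3 : -(r ^ 2 * b' r) / (r ^ 2 + b r ^ 2) ^ p =
          -(r ^ (-α) * (ψ (b r / r) * (b' r / r))) := by
        rw [e1, e2, Real.rpow_neg hr.le]
        field_simp
      -- The first two terms on the right are nonnegative because `α`, `Φ (b r / r)` and `b r` are;
      -- the last one is the integrand.
      have e4 : -Ψ' r = α * r ^ (-α - 1) * Φ (b r / r) + r ^ (-α) * ψ (b r / r) * (b r / r ^ 2)
          + -(r ^ (-α) * (ψ (b r / r) * (b' r / r))) := by
        simp only [hΨ']
        field_simp
        ring
      rw [e3, e4]
      have := hΦ₀ (b r / r) (div_nonneg (hb₀ r) hr.le)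
      have := hψ₀ (b r / r)
      have := hb₀ r
      have : 0 ≤ α * r ^ (-α - 1) * Φ (b r / r) + r ^ (-α) * ψ (b r / r) * (b r / r ^ 2) := by
        positivity
      linarith
  refine key.trans ?_
  have hR' : 0 < R := hε.trans_le hR
  have h1 : 0 ≤ Ψ R := mul_nonneg (by positivity) (hΦ₀ _ (div_nonneg (hb₀ R) hR'.le))
  have h2 : Ψ ε ≤ ε ^ (-α) * (b ε / ε) :=
    mul_le_mul_of_nonneg_left (hΦ₁ _ (div_nonneg (hb₀ ε) hε.le)) (by positivity)
  simp only [Pi.neg_apply]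
  linarith

theorem integral_annulus_eq {F : Plane → ℝ} {ε R : ℝ} (hε : 0 < ε)
    (hF : IntegrableOn F {y : Plane | ε < ‖y‖ ∧ ‖y‖ < R}) :
    ∫ y in {y : Plane | ε < ‖y‖ ∧ ‖y‖ < R}, F y =
      ∫ ω : Metric.sphere (0 : Plane) 1, (∫ r in Ioo ε R, r * F (r • (ω : Plane)))
        ∂(volume : Measure Plane).toSphere := by
  set A := {y : Plane | ε < ‖y‖ ∧ ‖y‖ < R} with hA
  have hAm : MeasurableSet A :=
    ((isOpen_lt continuous_const continuous_norm).inter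
      (isOpen_lt continuous_norm continuous_const)).measurableSet
  set G := A.indicator F with hG
  have hGi : Integrable G := (integrable_indicator_iff hAm).2 hF
  have hmp := (volume : Measure Plane).measurePreserving_homeomorphUnitSphereProd
  have hemb := (homeomorphUnitSphereProd Plane).measurableEmbedding
  have hfin : Module.finrank ℝ Plane - 1 = 1 := by simp
  rw [hfin] at hmp
  set H : Metric.sphere (0 : Plane) 1 × Ioi (0 : ℝ) → ℝ := fun z ↦ G ((z.2 : ℝ) • (z.1 : Plane))
  have hH : ∀ y : ({0}ᶜ : Set Plane), H (homeomorphUnitSphereProd Plane y) = G y := by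
    intro y
    have : ‖(y : Plane)‖ ≠ 0 := norm_ne_zero_iff.2 y.2
    simp [H, smul_smul, this]
  have hint : Integrable H ((volume : Measure Plane).toSphere.prod (.volumeIoiPow 1)) := by
    rw [← hmp.integrable_comp_emb hemb]
    have : H ∘ homeomorphUnitSphereProd Plane = G ∘ Subtype.val := funext hH
    rw [this, ← integrableOn_iff_comap_subtypeVal (measurableSet_singleton _).compl]
    exact hGi.integrableOn
  calc ∫ y in A, F y = ∫ y, G y := (integral_indicator hAm).symm
    _ = ∫ y : ({0}ᶜ : Set Plane), G y ∂(volume.comap Subtype.val) := by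
      rw [integral_subtype_comap (measurableSet_singleton _).compl G, restrict_compl_singleton]
    _ = ∫ z, H z ∂(volume : Measure Plane).toSphere.prod (.volumeIoiPow 1) := by
      rw [← hmp.integral_comp hemb]
      simp only [hH]
    _ = ∫ ω, ∫ r, H (ω, r) ∂(.volumeIoiPow 1) ∂(volume : Measure Plane).toSphere :=
      integral_prod _ hint
    _ = _ := by
      refine integral_congr_ae (.of_forall fun ω ↦ ?_)
      simp only [Measure.volumeIoiPow, ENNReal.ofReal]
      rw [integral_withDensity_eq_integral_smul
        ((measurable_subtype_coe.pow_const _).real_toNNReal),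
        integral_subtype_comap measurableSet_Ioi fun a ↦
          Real.toNNReal (a ^ 1) • G (a • (ω : Plane)),
        ← integral_indicator measurableSet_Ioi, ← integral_indicator measurableSet_Ioo]
      congr 1
      funext r
      have hω : ‖(ω : Plane)‖ = 1 := by simp
      by_cases hr : 0 < r
      · have h1 : (r • (ω : Plane) ∈ A) ↔ r ∈ Ioo ε R := by
          simp [hA, norm_smul, hω, abs_of_pos hr]
        rw [indicator_of_mem (show r ∈ Ioi 0 from hr), NNReal.smul_def,
          Real.coe_toNNReal _ (by positivity)]
        by_cases h2 : r ∈ Ioo ε R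
        · rw [indicator_of_mem h2, hG, indicator_of_mem (h1.2 h2)]; simp
        · rw [indicator_of_notMem h2, hG, indicator_of_notMem (fun h ↦ h2 (h1.1 h))]; simp
      · rw [indicator_of_notMem (show r ∉ Ioi 0 from hr),
          indicator_of_notMem fun h ↦ hr (hε.trans h.1)]

/-- The derivative vanishes at `x` and is differentiable there, hence is `O(‖y‖)` on the ball of
radius `‖y‖`; the mean value inequality gives the second factor. -/
theorem exists_sub_le_mul_norm_sq {u : Plane → ℝ} (hu : ContDiff ℝ 2 u) {x : Plane}
    (hx : ∀ z, u z ≤ u x) :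
    ∃ C δ : ℝ, 0 ≤ C ∧ 0 < δ ∧ ∀ y : Plane, ‖y‖ < δ → u x - u (x - y) ≤ C * ‖y‖ ^ 2 := by
  have h0 : fderiv ℝ u x = 0 := IsLocalMax.fderiv_eq_zero (.of_forall hx)
  have hd : DifferentiableAt ℝ (fderiv ℝ u) x :=
    ((hu.fderiv_right (m := 1) (by norm_num)).differentiable (by norm_num)) x
  obtain ⟨C, hC⟩ := hd.isBigO_sub.bound
  obtain ⟨δ, hδ, hball⟩ := Metric.eventually_nhds_iff_ball.1 hC
  refine ⟨|C|, δ, abs_nonneg C, hδ, fun y hy ↦ ?_⟩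
  have hC₀ : ∀ z ∈ Metric.closedBall x ‖y‖, ‖fderiv ℝ u z‖ ≤ |C| * ‖y‖ := by
    intro z hz
    have h1 := hball z (Metric.closedBall_subset_ball hy hz)
    rw [h0, sub_zero] at h1
    refine h1.trans ?_
    rw [mem_closedBall_iff_norm] at hz
    exact mul_le_mul (le_abs_self C) hz (norm_nonneg _) (abs_nonneg _)
  have h2 := (convex_closedBall x ‖y‖).norm_image_sub_le_of_norm_fderiv_le
    (fun z _ ↦ hu.differentiable (by norm_num) z) hC₀
    (show x - y ∈ Metric.closedBall x ‖y‖ by simp)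
    (Metric.mem_closedBall_self (norm_nonneg y))
  rw [sub_sub_cancel] at h2
  calc _ ≤ _ := Real.le_norm_self _
    _ ≤ _ := h2
    _ = _ := by ring

theorem integral_Ioo_contourKernel_le {α : ℝ} (hα : 0 ≤ α) {u : Plane → ℝ}
    (hu : ContDiff ℝ 2 u) {x : Plane} (hx : ∀ z, u z ≤ u x) {ε R : ℝ} (hε : 0 < ε) (hR : ε ≤ R)
    {ω : Plane} (hω : ‖ω‖ = 1) :
    ∫ r in Ioo ε R, r * contourKernel α u x (r • ω) ≤ ε ^ (-α) * ((u x - u (x - ε • ω)) / ε) := by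
  have hd := hu.differentiable (by norm_num)
  have h0 : gradient u x = 0 := by
    rw [gradient, IsLocalMax.fderiv_eq_zero (.of_forall hx), map_zero]
  have hb : ∀ r : ℝ, HasDerivAt (fun r ↦ u x - u (x - r • ω)) (fderiv ℝ u (x - r • ω) ω) r := by
    intro r
    have h1 : HasDerivAt (fun r : ℝ ↦ x - r • ω) (-ω) r := by
      simpa using ((hasDerivAt_id r).smul_const ω).const_sub x
    simpa using ((hd (x - r • ω)).hasFDerivAt.comp_hasDerivAt r h1).const_sub (u x)
  have hb' : Continuous fun r : ℝ ↦ fderiv ℝ u (x - r • ω) ω :=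
    ((hu.continuous_fderiv (by norm_num)).comp (by fun_prop)).clm_apply continuous_const
  refine le_of_eq_of_le ?_
    (integral_ray_le hα hb hb' (fun r ↦ sub_nonneg.2 (hx _)) hε hR)
  rw [intervalIntegral.integral_of_le hR, integral_Ioc_eq_integral_Ioo]
  refine setIntegral_congr_fun measurableSet_Ioo fun r _ ↦ ?_
  have h2 : inner ℝ (gradient u (x - r • ω)) ω = fderiv ℝ u (x - r • ω) ω := by
    rw [gradient, InnerProductSpace.toDual_symm_apply]
  simp only [contourKernel, h0, zero_sub, inner_neg_left, inner_smul_right, h2, norm_smul, hω,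
    mul_one, Real.norm_eq_abs, sq_abs]
  ring

theorem HasPV.nonpos_of_forall_le {α : ℝ} (hα₀ : 0 ≤ α) (hα₁ : α < 1) {u : Plane → ℝ}
    (hu : ContDiff ℝ 2 u) {x : Plane} (hx : ∀ z, u z ≤ u x) {L : ℝ}
    (hL : HasPV (contourKernel α u x) L) : L ≤ 0 := by
  obtain ⟨C, δ, hC, hδ, hCδ⟩ := exists_sub_le_mul_norm_sq hu hx
  set σ := (volume : Measure Plane).toSphere
  have hlim : Tendsto (fun p : ℝ × ℝ ↦ σ.real univ * (C * p.1 ^ (1 - α)))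
      (𝓝[>] (0 : ℝ) ×ˢ atTop) (𝓝 0) := by
    have h1 : Tendsto (fun r : ℝ ↦ r ^ (1 - α)) (𝓝[>] 0) (𝓝 0) := by
      have := (Real.continuousAt_rpow_const 0 (1 - α) (Or.inr (by linarith))).tendsto
      rw [Real.zero_rpow (by linarith)] at this
      exact this.mono_left nhdsWithin_le_nhds
    simpa using ((h1.comp tendsto_fst).const_mul C).const_mul (σ.real univ)
  refine le_of_tendsto_of_tendsto hL.2 hlim ?_
  have hev : ∀ᶠ p : ℝ × ℝ in 𝓝[>] (0 : ℝ) ×ˢ atTop, (0 < p.1 ∧ p.1 < δ) ∧ δ < p.2 :=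
    Eventually.prod_mk (show ∀ᶠ r : ℝ in 𝓝[>] 0, 0 < r ∧ r < δ from Ioo_mem_nhdsGT hδ)
      (eventually_gt_atTop δ)
  filter_upwards [hev] with p ⟨⟨h0, h1⟩, h2⟩
  rw [integral_annulus_eq h0 (hL.1 _ _ h0)]
  have hpt : ∀ ω : Metric.sphere (0 : Plane) 1,
      ∫ r in Ioo p.1 p.2, r * contourKernel α u x (r • (ω : Plane)) ≤ C * p.1 ^ (1 - α) := by
    intro ω
    have hω : ‖(ω : Plane)‖ = 1 := by simp
    have hn : ‖p.1 • (ω : Plane)‖ = p.1 := by rw [norm_smul, hω, mul_one, Real.norm_of_nonneg h0.le]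
    refine (integral_Ioo_contourKernel_le hα₀ hu hx h0 (h1.trans h2).le hω).trans ?_
    have h3 := hCδ (p.1 • (ω : Plane)) (by rwa [hn])
    rw [hn] at h3
    calc _ ≤ p.1 ^ (-α) * (C * p.1 ^ 2 / p.1) := by gcongr
      _ = C * p.1 ^ (1 - α) := by
        rw [sub_eq_neg_add, Real.rpow_add h0, Real.rpow_one]
        field_simp
  -- If the ray integrals were not integrable over the circle, the outer integral would be `0` by
  -- convention, still below the nonnegative bound.
  by_cases hi : Integrable
      (fun ω : Metric.sphere (0 : Plane) 1 ↦
        ∫ r in Ioo p.1 p.2, r * contourKernel α u x (r • (ω : Plane))) σ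
  · calc _ ≤ ∫ _ : Metric.sphere (0 : Plane) 1, C * p.1 ^ (1 - α) ∂σ :=
          integral_mono hi (integrable_const _) hpt
      _ = _ := by simp
  · rw [integral_undef hi]
    positivity

/-! ### Maximum principle in space and time. -/

theorem derivWithin_nonneg_of_forall_le {T t d : ℝ} {g : ℝ → ℝ} (ht : t ∈ Ioc 0 T)
    (hg : HasDerivWithinAt g d (Icc 0 T) t) (hmax : ∀ s ∈ Icc 0 T, g s ≤ g t) : 0 ≤ d := by
  -- Difference quotients from the left suffice, which also covers `t = T`.
  have h1 : HasDerivWithinAt g d (Ioo 0 t) t :=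
    hg.mono fun s hs ↦ ⟨hs.1.le, hs.2.le.trans ht.2⟩
  have h2 := (hasDerivWithinAt_iff_tendsto_slope' (by simp)).1 h1
  have : (𝓝[Ioo 0 t] t).NeBot := by
    rw [nhdsWithin_Ioo_eq_nhdsLT ht.1]; infer_instance
  refine ge_of_tendsto h2 ?_
  filter_upwards [self_mem_nhdsWithin] with s hs
  rw [slope_def_field]
  exact div_nonneg_of_nonpos (sub_nonpos.2 (hmax s ⟨hs.1.le, hs.2.le.trans ht.2⟩))
    (sub_nonpos.2 hs.2.le)

/-- A continuous curve of functions vanishing at infinity, over a compact set of times, minus a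
multiple of time, attains its maximum if it is positive somewhere. -/
theorem exists_forall_sub_mul_le {T δ : ℝ} (hδ : 0 ≤ δ) {f : ℝ → Plane → ℝ}
    (hc : ∀ t ∈ Icc 0 T, Continuous (f t))
    (hz : ∀ t ∈ Icc 0 T, Tendsto (f t) (cocompact Plane) (𝓝 0))
    (hu : ∀ t ∈ Icc 0 T, TendstoUniformly f (f t) (𝓝[Icc 0 T] t))
    {t₀ : ℝ} (ht₀ : t₀ ∈ Icc 0 T) {x₀ : Plane} (hpos : 0 < f t₀ x₀ - δ * t₀) :
    ∃ t ∈ Icc 0 T, ∃ x, ∀ s ∈ Icc 0 T, ∀ z, f s z - δ * s ≤ f t x - δ * t := by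
  set m := f t₀ x₀ - δ * t₀ with hm
  -- Decay uniform in time: near each time, `m / 2` bounds the function far out and `m / 2` its
  -- variation; compactness of `[0, T]` does the rest.
  have hfar : ∀ᶠ x in cocompact Plane, ∀ t ∈ Icc 0 T, f t x < m := by
    refine isCompact_Icc.induction_on (p := fun S ↦ ∀ᶠ x in cocompact Plane, ∀ t ∈ S, f t x < m)
      (by simp) (fun S S' hS h ↦ h.mono fun x hx t ht ↦ hx t (hS ht))
      (fun S S' h h' ↦ ?_) fun t ht ↦ ?_
    · filter_upwards [h, h'] with x hx hx' t ht using ht.elim (hx t) (hx' t)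
    · refine ⟨_, Metric.tendstoUniformly_iff.1 (hu t ht) (m / 2) (by positivity), ?_⟩
      filter_upwards [(hz t ht).eventually_lt_const (show 0 < m / 2 by positivity)] with x hx s hs
      have := (abs_lt.1 (Real.dist_eq _ _ ▸ hs x)).1
      linarith
  obtain ⟨K, hK, hKm⟩ := mem_cocompact.1 hfar
  have hcont : ContinuousOn (fun p : ℝ × Plane ↦ f p.1 p.2 - δ * p.1) (Icc 0 T ×ˢ univ) := by
    refine ContinuousOn.sub (fun p hp ↦ ?_) (by fun_prop)
    have h1 : Tendsto Prod.fst (𝓝[Icc 0 T ×ˢ univ] p) (𝓝[Icc 0 T] p.1) :=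
      tendsto_nhdsWithin_of_tendsto_nhds_of_eventually_within _
        continuous_fst.continuousWithinAt
        (by filter_upwards [self_mem_nhdsWithin] with q hq using hq.1)
    have h2 : TendstoUniformly (fun q : ℝ × Plane ↦ f q.1) (f p.1) (𝓝[Icc 0 T ×ˢ univ] p) :=
      fun U hU ↦ h1.eventually (hu p.1 hp.1 U hU)
    exact h2.tendsto_comp (hc p.1 hp.1).continuousAt continuous_snd.continuousWithinAt
  have hx₀K : x₀ ∈ K := by
    by_contra h
    have := hKm h t₀ ht₀
    have : 0 ≤ δ * t₀ := mul_nonneg hδ ht₀.1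
    linarith [hKm h t₀ ht₀]
  obtain ⟨⟨t, x⟩, ⟨ht, -⟩, hmax⟩ := (isCompact_Icc.prod hK).exists_isMaxOn
    ⟨(t₀, x₀), ht₀, hx₀K⟩ (hcont.mono (prod_mono_right (subset_univ K)))
  refine ⟨t, ht, x, fun s hs z ↦ ?_⟩
  by_cases hzK : z ∈ K
  · exact hmax (show (s, z) ∈ Icc 0 T ×ˢ K from ⟨hs, hzK⟩)
  · have h1 : f s z < m := hKm hzK s hs
    have h2 : m ≤ f t x - δ * t := hmax (show (t₀, x₀) ∈ Icc 0 T ×ˢ K from ⟨ht₀, hx₀K⟩)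
    have : 0 ≤ δ * s := mul_nonneg hδ hs.1
    linarith

theorem le_of_contour_eq {α c T M : ℝ} (hα₀ : 0 ≤ α) (hα₁ : α < 1) (hc₀ : 0 ≤ c) (hM : 0 ≤ M)
    {f : ℝ → Plane → ℝ} (hc : ∀ t ∈ Icc 0 T, ContDiff ℝ 2 (f t))
    (hz : ∀ t ∈ Icc 0 T, Tendsto (f t) (cocompact Plane) (𝓝 0))
    (hu : ∀ t ∈ Icc 0 T, TendstoUniformly f (f t) (𝓝[Icc 0 T] t))
    (heq : ∀ t ∈ Icc 0 T, ∀ x, ∃ L, HasPV (contourKernel α (f t) x) L ∧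
      HasDerivWithinAt (fun s ↦ f s x) (c * L) (Icc 0 T) t)
    (h0 : ∀ x, f 0 x ≤ M) {t : ℝ} (ht : t ∈ Icc 0 T) (x : Plane) : f t x ≤ M := by
  have key : ∀ δ > 0, f t x - δ * t ≤ M := by
    intro δ hδ
    by_contra! hlt
    obtain ⟨t₁, ht₁, x₁, hmax⟩ := exists_forall_sub_mul_le hδ.le (fun t ht ↦ (hc t ht).continuous)
      hz hu ht (hM.trans_lt hlt)
    -- At time zero the penalised function is at most `M`, below its value at `(t, x)`.
    have hpos : t₁ ≠ 0 := by
      rintro rfl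
      have := hmax t ht x
      have := h0 x₁
      linarith
    obtain ⟨L, hL, hd⟩ := heq t₁ ht₁ x₁
    have hL₀ : L ≤ 0 := hL.nonpos_of_forall_le hα₀ hα₁ (hc t₁ ht₁)
      fun z ↦ by linarith [hmax t₁ ht₁ z]
    have hd' : HasDerivWithinAt (fun s ↦ f s x₁ - δ * s) (c * L - δ * 1) (Icc 0 T) t₁ :=
      hd.sub ((hasDerivWithinAt_id _ _).const_mul δ)
    have := derivWithin_nonneg_of_forall_le ⟨ht₁.1.lt_of_ne' hpos, ht₁.2⟩ hd'
      fun s hs ↦ hmax s hs x₁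
    linarith [mul_nonpos_of_nonneg_of_nonpos hc₀ hL₀]
  have hlim : Tendsto (fun δ : ℝ ↦ f t x - δ * t) (𝓝[>] 0) (𝓝 (f t x - 0 * t)) :=
    Tendsto.mono_left (Continuous.tendsto (by fun_prop) 0) nhdsWithin_le_nhds
  have := le_of_tendsto hlim (by filter_upwards [self_mem_nhdsWithin] with δ hδ using key δ hδ)
  simpa using this

/-! ### Odd symmetry and the two-sided bound. -/

theorem contourKernel_neg (α : ℝ) (u : Plane → ℝ) (x : Plane) :
    contourKernel α (fun z ↦ -u z) x = fun y ↦ -contourKernel α u x y := by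
  have hg : ∀ z, gradient (fun z ↦ -u z) z = -gradient u z := fun z ↦ by
    simp [gradient, fderiv_fun_neg]
  funext y
  simp only [contourKernel, hg]
  rw [show -u x - -u (x - y) = -(u x - u (x - y)) by ring, neg_sq, neg_sub_neg,
    ← neg_sub, inner_neg_left, neg_div]

theorem HasPV.neg {F : Plane → ℝ} {L : ℝ} (h : HasPV F L) : HasPV (fun y ↦ -F y) (-L) := by
  refine ⟨fun ε R hε ↦ (h.1 ε R hε).neg, ?_⟩
  simp only [integral_neg]
  exact h.2.neg

end Muskat

theorem mainTheorem3 (α : ℝ) (hα₀ : 0 ≤ α) (hα₁ : α < 1)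
    (ρ₁ ρ₂ : ℝ) (hρ : ρ₁ < ρ₂) (k : ℕ) (hk : 4 ≤ k)
    (f₀ : Muskat.Plane → ℝ) (hf₀ : Muskat.MemH k f₀)
    (T : ℝ) (hT : 0 < T) (f : ℝ → Muskat.Plane → ℝ)
    (hf : Muskat.IsSolution α ρ₁ ρ₂ k T f₀ f) :
    ∀ t ∈ Icc 0 T, eLpNorm (f t) ∞ volume ≤ eLpNorm f₀ ∞ volume := by
  have hk' : (3 : ℝ) < k := by exact_mod_cast hk
  have hk₁ : (1 : ℝ) < k := by linarith
  have hu : ∀ t ∈ Icc 0 T, TendstoUniformly f (f t) (𝓝[Icc 0 T] t) := fun t ht ↦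
    hf.continuousOnH.tendstoUniformly hk₁ hf.continuous ht
  have hlift : ∀ t ∈ Icc 0 T, ∃ v, Muskat.IsBesselLift k (f t) v := fun t ht ↦
    (Muskat.memH_iff_exists_isBesselLift k (f t)).1 (hf.continuousOnH.memH ht)
  have hc : ∀ t ∈ Icc 0 T, ContDiff ℝ 2 (f t) := fun t ht ↦
    (hlift t ht).choose_spec.contDiff hk' (hf.continuous t ht)
  have hz : ∀ t ∈ Icc 0 T, Tendsto (f t) (cocompact _) (𝓝 0) := fun t ht ↦
    (hlift t ht).choose_spec.tendsto_zero hk₁ (hf.continuous t ht)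
  have hcoef : 0 ≤ (ρ₂ - ρ₁) / (4 * Real.pi) :=
    div_nonneg (sub_nonneg.2 hρ.le) (by positivity)
  have h0T : (0 : ℝ) ∈ Icc 0 T := ⟨le_rfl, hT.le⟩
  rw [← eLpNorm_congr_ae hf.initial]
  rcases eq_or_ne (eLpNorm (f 0) ∞ volume) ∞ with htop | hne
  · simp [htop]
  set M := (eLpNorm (f 0) ∞ volume).toReal with hM
  -- The essential bound holds on a dense set, hence everywhere by continuity.
  have hbound : ∀ x, |f 0 x| ≤ M := by
    have hae : ∀ᵐ x, |f 0 x| ≤ M := by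
      filter_upwards [ae_le_eLpNormEssSup (f := f 0) (μ := volume)] with x hx
      rw [hM, ← Real.norm_eq_abs, ← toReal_enorm]
      exact ENNReal.toReal_mono hne (by rwa [eLpNorm_exponent_top])
    have hcl : IsClosed {x | |f 0 x| ≤ M} :=
      isClosed_le (hf.continuous 0 h0T).abs continuous_const
    intro x
    have : x ∈ closure {x | |f 0 x| ≤ M} := (Measure.dense_of_ae hae) x
    rwa [hcl.closure_eq] at this
  intro t ht
  have h1 : ∀ x, f t x ≤ M := Muskat.le_of_contour_eq hα₀ hα₁ hcoef ENNReal.toReal_nonneg hc hz hu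
    hf.contour_eq (fun x ↦ (abs_le.1 (hbound x)).2) ht
  have h2 : ∀ x, -f t x ≤ M := by
    refine Muskat.le_of_contour_eq (f := fun t x ↦ -f t x) hα₀ hα₁ hcoef ENNReal.toReal_nonneg
      (fun t ht ↦ (hc t ht).neg) (fun t ht ↦ by simpa using (hz t ht).neg)
      (fun t ht ↦ ?_) (fun t ht x ↦ ?_)
      (fun x ↦ neg_le.1 (abs_le.1 (hbound x)).1) ht
    · exact uniformContinuous_neg.comp_tendstoUniformly (hu t ht)
    · obtain ⟨L, hL, hd⟩ := hf.contour_eq t ht x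
      refine ⟨-L, ?_, ?_⟩
      · rw [Muskat.contourKernel_neg]
        exact hL.neg
      · rw [mul_neg]
        exact hd.neg
  rw [← ENNReal.ofReal_toReal hne, eLpNorm_exponent_top]
  refine eLpNormEssSup_le_of_ae_bound (.of_forall fun x ↦ ?_)
  exact abs_le.2 ⟨neg_le.1 (h2 x), h1 x⟩
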